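/- Let $n\ge 2$. Identify a type II bilinear system of dimension $n$, $$\dot x=(A+uN)x,\quad x(0)=b,\qquad y=cx,$$ with $A,N\in\mathbb R^{n\times n}$, $b\in\mathbb R^{n\times 1}$, $c\in\mathbb R^{1\times n}$, with its 4-tuple $(A,N,b,c)\in\mathbb R^{2n^2+2n}$. Inputs are the Lebesgue-measurable, essentially bounded functions $u:[0,T]\to\mathbb R$ with $0\le T<\infty$. Two systems are i/o equivalent under an input $u:[0,T]\to\mathbb R$ if the corresponding outputs satisfy $y(t)=\widehat y(t)$ for all $t\in[0,T]$, and they are i/o equivalent if this holds for every input. A subset of $\mathbb R^{\ell}$ is generic if it is open and dense and its complement has Lebesgue measure zero. There is a generic set $\mathcal G\subseteq\mathbb R^{2n^2+2n}$ of type II bilinear systems of dimension $n$ such that for every $\sigma\in\mathcal G$ there is some $\widehat\sigma\in\mathcal G$ for which 1. $\sigma$ and $\widehat\sigma$ are i/o equivalent under every constant input $u\equiv\beta$ on $[0,T]$ ($\beta\in\mathbb R$, $T\ge 0$), but 2. $\sigma$ and $\widehat\sigma$ are not i/o equivalent. -/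

import Mathlib

open MeasureTheory Set
open scoped Matrix

namespace BilinearSys

/-! ### Inputs -/

/-- An input: a Lebesgue-measurable, essentially bounded function on an interval `[0, T]`.
Only the values of `val` on `[0, T]` matter. -/
structure Input where
  /-- the length of the time interval -/
  T : ℝ
  T_nonneg : 0 ≤ T
  /-- the input function, to be read on `[0, T]` only -/
  val : ℝ → ℝ
  memLp_top : MemLp val ⊤ (volume.restrict (Icc 0 T))

/-- The constant (step) inputs, on all intervals `[0, T]` and with all values. -/
def constantInputs : Set Input :=
  {u | ∃ β : ℝ, ∀ t ∈ Icc 0 u.T, u.val t = β}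

/-! ### 4-tuples and type II bilinear systems -/

/-- The 4-tuples `(A, N, b, c)` of dimension `n`, that is, the Euclidean space of dimension
`2 n ^ 2 + 2 n` with its usual topology and Lebesgue measure. A type II bilinear system of
dimension `n` is identified with its 4-tuple. -/
abbrev FourTuple (n : ℕ) : Type :=
  (Fin n → Fin n → ℝ) × (Fin n → Fin n → ℝ) × (Fin n → ℝ) × (Fin n → ℝ)

namespace FourTuple

variable {n : ℕ}

/-- The matrix `A`. -/
def A (σ : FourTuple n) : Matrix (Fin n) (Fin n) ℝ := Matrix.of σ.1

/-- The matrix `N`. -/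
def N (σ : FourTuple n) : Matrix (Fin n) (Fin n) ℝ := Matrix.of σ.2.1

/-- The column vector `b`. -/
def b (σ : FourTuple n) : Fin n → ℝ := σ.2.2.1

/-- The row vector `c`. -/
def c (σ : FourTuple n) : Fin n → ℝ := σ.2.2.2

end FourTuple

/-- `x` is a (Carathéodory) solution on `[0, T]` of the type II system
`x' = (A + u N) x`, `x(0) = b`: a continuous function that satisfies the integral equation. -/
def IsSolution {n : ℕ} (σ : FourTuple n) (u : Input) (x : ℝ → Fin n → ℝ) : Prop :=
  ContinuousOn x (Icc 0 u.T) ∧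
    ∀ t ∈ Icc 0 u.T, x t = σ.b + ∫ s in (0 : ℝ)..t, (σ.A + u.val s • σ.N) *ᵥ x s

/-! ### Existence and uniqueness of solutions -/

section WellPosed

variable {E : Type*} [NormedAddCommGroup E] [NormedSpace ℝ E]

theorem integrableOn_rhs (P Q : E →L[ℝ] E) {T : ℝ} {u : ℝ → ℝ}
    (hu : MemLp u ⊤ (volume.restrict (Icc 0 T))) {x : ℝ → E} (hx : ContinuousOn x (Icc 0 T)) :
    IntegrableOn (fun s => P (x s) + u s • Q (x s)) (Icc 0 T) := by
  have h1 : IntegrableOn (fun s => P (x s)) (Icc 0 T) :=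
    (P.continuous.comp_continuousOn hx).integrableOn_compact isCompact_Icc
  have h2 : IntegrableOn (fun s => Q (x s)) (Icc 0 T) :=
    (Q.continuous.comp_continuousOn hx).integrableOn_compact isCompact_Icc
  exact Integrable.add h1 (Integrable.smul_of_top_right h2 hu)

theorem intervalIntegrable_rhs (P Q : E →L[ℝ] E) {T : ℝ} {u : ℝ → ℝ}
    (hu : MemLp u ⊤ (volume.restrict (Icc 0 T))) {x : ℝ → E} (hx : ContinuousOn x (Icc 0 T))
    {t : ℝ} (ht : t ∈ Icc 0 T) :
    IntervalIntegrable (fun s => P (x s) + u s • Q (x s)) volume 0 t := by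
  rw [intervalIntegrable_iff_integrableOn_Icc_of_le ht.1]
  exact (integrableOn_rhs P Q hu hx).mono_set (Icc_subset_Icc_right ht.2)

theorem continuousOn_rhs [CompleteSpace E] (P Q : E →L[ℝ] E) {T : ℝ} (hT : 0 ≤ T) {u : ℝ → ℝ}
    (hu : MemLp u ⊤ (volume.restrict (Icc 0 T))) {x : ℝ → E} (hx : ContinuousOn x (Icc 0 T)) :
    ContinuousOn (fun t => ∫ s in (0 : ℝ)..t, (P (x s) + u s • Q (x s))) (Icc 0 T) := by
  have := intervalIntegral.continuousOn_primitive_interval' (μ := volume)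
    (intervalIntegrable_rhs P Q hu hx (right_mem_Icc.2 hT)) left_mem_uIcc
  rwa [uIcc_of_le hT] at this

theorem exists_rhs_bound (P Q : E →L[ℝ] E) {T : ℝ} {u : ℝ → ℝ}
    (hu : MemLp u ⊤ (volume.restrict (Icc 0 T))) :
    ∃ M : ℝ, 0 ≤ M ∧ ∀ᵐ s, s ∈ Icc 0 T → ∀ v : E, ‖P v + u s • Q v‖ ≤ M * ‖v‖ := by
  obtain ⟨C, hC⟩ : ∃ C : ℝ, ∀ᵐ s ∂(volume.restrict (Icc 0 T)), ‖u s‖ ≤ C := by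
    refine ⟨(eLpNormEssSup u (volume.restrict (Icc 0 T))).toReal, ?_⟩
    have hfin : eLpNormEssSup u (volume.restrict (Icc 0 T)) ≠ ⊤ := by
      simpa using hu.2.ne
    filter_upwards [ae_le_eLpNormEssSup (f := u) (μ := volume.restrict (Icc 0 T))] with s hs
    have := ENNReal.toReal_mono hfin hs
    simpa using this
  rw [ae_restrict_iff' measurableSet_Icc] at hC
  refine ⟨‖P‖ + |C| * ‖Q‖, by positivity, ?_⟩
  filter_upwards [hC] with s hs hmem v
  calc ‖P v + u s • Q v‖ ≤ ‖P v‖ + ‖u s‖ * ‖Q v‖ := by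
        simpa [norm_smul] using norm_add_le (P v) (u s • Q v)
    _ ≤ ‖P‖ * ‖v‖ + |C| * (‖Q‖ * ‖v‖) := by
        gcongr
        · exact P.le_opNorm v
        · exact (hs hmem).trans (le_abs_self C)
        · exact Q.le_opNorm v
    _ = _ := by ring

theorem picard_step (P Q : E →L[ℝ] E) {T : ℝ} {u : ℝ → ℝ} {M : ℝ}
    (hM : ∀ᵐ s, s ∈ Icc 0 T → ∀ v : E, ‖P v + u s • Q v‖ ≤ M * ‖v‖) (hM0 : 0 ≤ M)
    {x : ℝ → E} {K : ℝ} {k : ℕ}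
    (hx : ∀ t ∈ Icc 0 T, ‖x t‖ ≤ K * ((M * t) ^ k / k.factorial)) {t : ℝ} (ht : t ∈ Icc 0 T) :
    ‖∫ s in (0 : ℝ)..t, (P (x s) + u s • Q (x s))‖
      ≤ K * ((M * t) ^ (k + 1) / (k + 1).factorial) := by
  have h := intervalIntegral.norm_integral_le_of_norm_le (μ := volume)
    (f := fun s => P (x s) + u s • Q (x s))
    (g := fun s => (M ^ (k + 1) * K / k.factorial) * s ^ k) ht.1 (by
      filter_upwards [hM] with s hs hmem
      have hs' : s ∈ Icc 0 T := ⟨hmem.1.le, hmem.2.trans ht.2⟩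
      calc ‖P (x s) + u s • Q (x s)‖ ≤ M * ‖x s‖ := hs hs' _
        _ ≤ M * (K * ((M * s) ^ k / k.factorial)) := by gcongr; exact hx s hs'
        _ = _ := by ring) (by apply Continuous.intervalIntegrable; fun_prop)
  refine h.trans (le_of_eq ?_)
  rw [intervalIntegral.integral_const_mul, integral_pow, Nat.factorial_succ]
  have h1 : (k.factorial : ℝ) ≠ 0 := by positivity
  have h2 : ((k : ℝ) + 1) ≠ 0 := by positivity
  push_cast
  field_simp
  ring

theorem exists_solution [CompleteSpace E] (P Q : E →L[ℝ] E) (x₀ : E) {T : ℝ} (hT : 0 ≤ T)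
    {u : ℝ → ℝ} (hu : MemLp u ⊤ (volume.restrict (Icc 0 T))) :
    ∃ x : ℝ → E, ContinuousOn x (Icc 0 T) ∧
      ∀ t ∈ Icc 0 T, x t = x₀ + ∫ s in (0 : ℝ)..t, (P (x s) + u s • Q (x s)) := by
  obtain ⟨M, hM0, hM⟩ := exists_rhs_bound P Q hu
  let y : ℕ → ℝ → E := fun k => Nat.rec (fun _ => x₀)
    (fun _ z t => ∫ s in (0 : ℝ)..t, (P (z s) + u s • Q (z s))) k
  have y0 : ∀ t, y 0 t = x₀ := fun t => rfl
  have ys : ∀ k t, y (k + 1) t = ∫ s in (0 : ℝ)..t, (P (y k s) + u s • Q (y k s)) :=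
    fun k t => rfl
  have hyc : ∀ k, ContinuousOn (y k) (Icc 0 T) := by
    intro k
    induction k with
    | zero => exact continuousOn_const
    | succ k ih => exact continuousOn_rhs P Q hT hu ih
  have hyb : ∀ k, ∀ t ∈ Icc 0 T, ‖y k t‖ ≤ ‖x₀‖ * ((M * t) ^ k / k.factorial) := by
    intro k
    induction k with
    | zero => intro t _; simp [y0]
    | succ k ih => intro t ht; exact picard_step P Q hM hM0 ih ht
  have hyB : ∀ k, ∀ t ∈ Icc 0 T, ‖y k t‖ ≤ ‖x₀‖ * ((M * T) ^ k / k.factorial) := by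
    intro k t ht
    refine (hyb k t ht).trans ?_
    have := ht.1
    have := ht.2
    gcongr
  have hsum : Summable fun k : ℕ => ‖x₀‖ * ((M * T) ^ k / k.factorial) :=
    (Real.summable_pow_div_factorial (M * T)).mul_left _
  have hys : ∀ t ∈ Icc 0 T, Summable fun k => y k t := fun t ht =>
    Summable.of_norm_bounded hsum fun k => hyB k t ht
  refine ⟨fun t => ∑' k, y k t, continuousOn_tsum hyc hsum hyB, ?_⟩
  intro t ht
  have hI : HasSum (fun k => ∫ s in (0 : ℝ)..t, (P (y k s) + u s • Q (y k s)))
      (∫ s in (0 : ℝ)..t, (P (∑' k, y k s) + u s • Q (∑' k, y k s))) := by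
    refine intervalIntegral.hasSum_integral_of_dominated_convergence
      (fun k _ => M * (‖x₀‖ * ((M * T) ^ k / k.factorial))) ?_ ?_ ?_ ?_ ?_
    · intro k
      have := (intervalIntegrable_rhs P Q hu (hyc k) ht).aestronglyMeasurable
      rwa [uIoc_of_le ht.1]
    · intro k
      filter_upwards [hM] with s hs hmem
      rw [uIoc_of_le ht.1] at hmem
      have hs' : s ∈ Icc 0 T := ⟨hmem.1.le, hmem.2.trans ht.2⟩
      exact (hs hs' _).trans (by gcongr; exact hyB k s hs')
    · exact Filter.Eventually.of_forall fun s _ => hsum.mul_left M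
    · exact intervalIntegrable_const
    · refine Filter.Eventually.of_forall fun s hmem => ?_
      rw [uIoc_of_le ht.1] at hmem
      have hs' : s ∈ Icc 0 T := ⟨hmem.1.le, hmem.2.trans ht.2⟩
      exact (P.hasSum (hys s hs').hasSum).add ((Q.hasSum (hys s hs').hasSum).const_smul (u s))
  change ∑' k, y k t = _
  rw [(hys t ht).tsum_eq_zero_add, y0, ← hI.tsum_eq]

theorem solution_unique (P Q : E →L[ℝ] E) (x₀ : E) {T : ℝ}
    {u : ℝ → ℝ} (hu : MemLp u ⊤ (volume.restrict (Icc 0 T))) {x z : ℝ → E}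
    (hxc : ContinuousOn x (Icc 0 T)) (hzc : ContinuousOn z (Icc 0 T))
    (hx : ∀ t ∈ Icc 0 T, x t = x₀ + ∫ s in (0 : ℝ)..t, (P (x s) + u s • Q (x s)))
    (hz : ∀ t ∈ Icc 0 T, z t = x₀ + ∫ s in (0 : ℝ)..t, (P (z s) + u s • Q (z s))) :
    EqOn x z (Icc 0 T) := by
  obtain ⟨M, hM0, hM⟩ := exists_rhs_bound P Q hu
  obtain ⟨K, hK⟩ := isCompact_Icc.exists_bound_of_continuousOn (hxc.sub hzc)
  have hd : ∀ t ∈ Icc 0 T, x t - z t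
      = ∫ s in (0 : ℝ)..t, (P (x s - z s) + u s • Q (x s - z s)) := by
    intro t ht
    rw [hx t ht, hz t ht, add_sub_add_left_eq_sub, ← intervalIntegral.integral_sub
      (intervalIntegrable_rhs P Q hu hxc ht) (intervalIntegrable_rhs P Q hu hzc ht)]
    congr 1
    funext s
    rw [map_sub, map_sub, smul_sub]
    abel
  have hb : ∀ k : ℕ, ∀ t ∈ Icc 0 T, ‖x t - z t‖ ≤ K * ((M * t) ^ k / k.factorial) := by
    intro k
    induction k with
    | zero => intro t ht; simpa using hK t ht
    | succ k ih =>
      intro t ht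
      rw [hd t ht]
      exact picard_step P Q (x := fun s => x s - z s) hM hM0 ih ht
  intro t ht
  have hlim : Filter.Tendsto (fun k : ℕ => K * ((M * t) ^ k / k.factorial)) Filter.atTop
      (nhds 0) := by
    simpa using (FloorSemiring.tendsto_pow_div_factorial_atTop (M * t)).const_mul K
  have := ge_of_tendsto' hlim fun k => hb k t ht
  exact sub_eq_zero.1 (norm_le_zero_iff.1 this)

end WellPosed

theorem rhs_eq {n : ℕ} (A N : Matrix (Fin n) (Fin n) ℝ) (r : ℝ) (v : Fin n → ℝ) :
    (A + r • N) *ᵥ v = LinearMap.toContinuousLinearMap (Matrix.mulVecLin A) v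
      + r • LinearMap.toContinuousLinearMap (Matrix.mulVecLin N) v := by
  simp [Matrix.add_mulVec, Matrix.smul_mulVec]

/-- Every input gives a solution on its whole interval. -/
theorem exists_isSolution {n : ℕ} (σ : FourTuple n) (u : Input) :
    ∃ x : ℝ → Fin n → ℝ, IsSolution σ u x := by
  simp only [IsSolution, rhs_eq]
  exact exists_solution _ _ σ.b u.T_nonneg u.memLp_top

/-- The solution is unique on the interval of the input. -/
theorem IsSolution.eqOn {n : ℕ} {σ : FourTuple n} {u : Input} {x z : ℝ → Fin n → ℝ}
    (hx : IsSolution σ u x) (hz : IsSolution σ u z) : EqOn x z (Icc 0 u.T) := by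
  simp only [IsSolution, rhs_eq] at hx hz
  exact solution_unique _ _ σ.b u.memLp_top hx.1 hz.1 hx.2 hz.2

/-! ### Outputs and input/output equivalence -/

/-- The solution of `x' = (A + u N) x`, `x(0) = b` on `[0, T]`. -/
noncomputable def state {n : ℕ} (σ : FourTuple n) (u : Input) : ℝ → Fin n → ℝ :=
  Classical.choose (exists_isSolution σ u)

theorem isSolution_state {n : ℕ} (σ : FourTuple n) (u : Input) : IsSolution σ u (state σ u) :=
  Classical.choose_spec (exists_isSolution σ u)

/-- The output `y = c x`. -/
noncomputable def output {n : ℕ} (σ : FourTuple n) (u : Input) (t : ℝ) : ℝ :=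
  σ.c ⬝ᵥ state σ u t

/-- Input/output equivalence with respect to all inputs in `U`: no input in `U` distinguishes
between the two systems. -/
def IOEquivOn {n m : ℕ} (U : Set Input) (σ : FourTuple n) (σ' : FourTuple m) : Prop :=
  ∀ u ∈ U, ∀ t ∈ Icc 0 u.T, output σ u t = output σ' u t

/-- Input/output equivalence: no input whatsoever distinguishes between the two systems. -/
def IOEquiv {n m : ℕ} (σ : FourTuple n) (σ' : FourTuple m) : Prop :=
  IOEquivOn univ σ σ'

/-! ### Generic sets -/

/-- A generic set: its complement has Lebesgue measure zero, and it is open and dense. -/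
def IsGeneric {n : ℕ} (G : Set (FourTuple n)) : Prop :=
  volume Gᶜ = 0 ∧ IsOpen G ∧ Dense G

end BilinearSys

/-! Pair σ = (A, N, b, c) with its dual (Aᵀ, Nᵀ, cᵀ, bᵀ). Under a constant input β the output is the
scalar c exp(t(A + βN)) b, which equals its own transpose, the output of the dual
(`ioEquivOn_constantInputs_dual`). An input that switches from 0 to 1 gives c exp(t(A + N)) exp(sA)
b, while the dual gives the two exponentials in the opposite order. If these agree for all s, t ≥ 0,
differentiating once in each variable at 0 yields c(AN - NA)b = 0
(`commutator_eq_zero_of_ioEquiv_dual`). So G is the set where c(AN - NA)b ≠ 0. Duality only flips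
the sign of this number, hence preserves G, and for n ≥ 2 its zero set is closed and null
(`isGeneric_commutator_ne_zero`). -/

namespace BilinearSys

/-! ### Matrix exponential flows -/

section Flow

attribute [local instance] Matrix.linftyOpNormedRing Matrix.linftyOpNormedAlgebra

/-- The solution `t ↦ exp (t M) v` of `x' = M x`, `x(0) = v`. -/
noncomputable def flow {n : ℕ} (M : Matrix (Fin n) (Fin n) ℝ) (v : Fin n → ℝ) (t : ℝ) :
    Fin n → ℝ :=
  NormedSpace.exp (t • M) *ᵥ v

theorem hasDerivAt_flow {n : ℕ} (M : Matrix (Fin n) (Fin n) ℝ) (v : Fin n → ℝ) (t : ℝ) :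
    HasDerivAt (flow M v) (M *ᵥ flow M v t) t := by
  let L : Matrix (Fin n) (Fin n) ℝ →ₗ[ℝ] (Fin n → ℝ) :=
    { toFun := fun P => P *ᵥ v
      map_add' := fun P Q => Matrix.add_mulVec P Q v
      map_smul' := fun r P => Matrix.smul_mulVec r P v }
  have h := (LinearMap.toContinuousLinearMap L).hasFDerivAt.comp_hasDerivAt t
    (hasDerivAt_exp_smul_const' (𝕂 := ℝ) M t)
  rw [flow, Matrix.mulVec_mulVec]
  exact h

end Flow

/-! ### Responses to switching and constant inputs -/

section Switching

variable {n : ℕ}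

theorem flow_zero (M : Matrix (Fin n) (Fin n) ℝ) (v : Fin n → ℝ) : flow M v 0 = v := by
  simp [flow]

theorem continuous_flow (M : Matrix (Fin n) (Fin n) ℝ) (v : Fin n → ℝ) : Continuous (flow M v) :=
  continuous_iff_continuousAt.2 fun t => (hasDerivAt_flow M v t).continuousAt

theorem flow_transpose_dotProduct (M : Matrix (Fin n) (Fin n) ℝ) (v w : Fin n → ℝ) (t : ℝ) :
    flow Mᵀ v t ⬝ᵥ w = v ⬝ᵥ flow M w t := by
  rw [flow, flow, ← Matrix.transpose_smul, Matrix.exp_transpose, Matrix.mulVec_transpose,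
    Matrix.dotProduct_mulVec]

/-- The response to an input that takes the value `α` until time `s` and the value `β` after it. -/
theorem state_of_switching (σ : FourTuple n) (u : Input) {s α β : ℝ} (hs : 0 ≤ s)
    (hu : ∀ t ∈ Icc 0 u.T, u.val t = if t ≤ s then α else β) {t : ℝ} (ht : t ∈ Icc 0 u.T) :
    state σ u t = flow (σ.A + β • σ.N) (flow (σ.A + α • σ.N) σ.b (min t s)) (max (t - s) 0) := by
  -- The clamps `min` and `max` put both phases in one formula: the second flow idles until `s`, the
  -- first is frozen after it.
  set x : ℝ → Fin n → ℝ := fun t =>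
    flow (σ.A + β • σ.N) (flow (σ.A + α • σ.N) σ.b (min t s)) (max (t - s) 0) with hx
  have hle : ∀ t, t ≤ s → x t = flow (σ.A + α • σ.N) σ.b t := by
    intro t h
    simp only [hx]
    rw [min_eq_left h, max_eq_right (sub_nonpos.2 h), flow_zero]
  have hge : ∀ t, s ≤ t →
      x t = flow (σ.A + β • σ.N) (flow (σ.A + α • σ.N) σ.b s) (t - s) := by
    intro t h
    simp only [hx]
    rw [min_eq_right h, max_eq_left (sub_nonneg.2 h)]
  have hc : Continuous x := by
    rw [show x = fun t => if t ≤ s then flow (σ.A + α • σ.N) σ.b t else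
        flow (σ.A + β • σ.N) (flow (σ.A + α • σ.N) σ.b s) (t - s) from ?_]
    · refine Continuous.if_le (continuous_flow _ _)
        ((continuous_flow _ _).comp (continuous_id.sub continuous_const)) continuous_id
        continuous_const ?_
      rintro t rfl
      simp [flow_zero]
    · funext t
      split_ifs with h
      · exact hle t h
      · exact hge t (not_le.1 h).le
  have hsol : IsSolution σ u x := by
    refine ⟨hc.continuousOn, fun r hr => ?_⟩
    have hint : IntervalIntegrable (fun τ => (σ.A + u.val τ • σ.N) *ᵥ x τ) volume 0 r := by
      simp only [rhs_eq]
      exact intervalIntegrable_rhs _ _ u.memLp_top hc.continuousOn hr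
    -- The trajectory may have a kink at `s`, so the fundamental theorem of calculus is used with
    -- the exceptional set `{s}`.
    have h := integral_eq_of_hasDerivAt_off_countable_of_le x
      (fun τ => (σ.A + u.val τ • σ.N) *ᵥ x τ) hr.1 (countable_singleton s) hc.continuousOn ?_ hint
    · have h0 : x 0 = σ.b := by rw [hle 0 hs, flow_zero]
      rw [h, h0, add_sub_cancel]
    · rintro τ ⟨⟨h0, hr'⟩, hτ⟩
      rw [hu τ ⟨h0.le, hr'.le.trans hr.2⟩]
      rcases lt_or_gt_of_ne hτ with h | h
      · rw [if_pos h.le, hle τ h.le]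
        refine (hasDerivAt_flow _ _ τ).congr_of_eventuallyEq ?_
        filter_upwards [Iio_mem_nhds h] with t ht using hle t (le_of_lt ht)
      · rw [if_neg (not_le.2 h), hge τ h.le]
        refine ((hasDerivAt_flow _ _ (τ - s)).comp_sub_const τ s).congr_of_eventuallyEq ?_
        filter_upwards [Ioi_mem_nhds h] with t ht using hge t (le_of_lt ht)
  exact (isSolution_state σ u).eqOn hsol ht

theorem state_of_constant (σ : FourTuple n) (u : Input) {β : ℝ}
    (hu : ∀ t ∈ Icc 0 u.T, u.val t = β) {t : ℝ} (ht : t ∈ Icc 0 u.T) :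
    state σ u t = flow (σ.A + β • σ.N) σ.b t := by
  -- Switching from `β` to `β` at the final time `T`, so the second phase has length zero.
  rw [state_of_switching σ u (α := β) (β := β) u.T_nonneg
    (fun t ht => by rw [hu t ht, ite_self]) ht, min_eq_left ht.2,
    max_eq_right (sub_nonpos.2 ht.2), flow_zero]

/-- The input on `[0, s + t]` that is `0` until time `s` and `1` after it. -/
noncomputable def stepInput (s t : ℝ) (hs : 0 ≤ s) (ht : 0 ≤ t) : Input where
  T := s + t
  T_nonneg := add_nonneg hs ht
  val := fun r => if r ≤ s then 0 else 1
  memLp_top := by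
    refine memLp_top_of_bound (C := 1) ?_ (Filter.Eventually.of_forall fun r => ?_)
    · exact (Measurable.ite measurableSet_Iic measurable_const
        measurable_const).aestronglyMeasurable
    · split_ifs <;> simp

theorem output_stepInput (σ : FourTuple n) {s t : ℝ} (hs : 0 ≤ s) (ht : 0 ≤ t) :
    output σ (stepInput s t hs ht) (s + t)
      = σ.c ⬝ᵥ flow (σ.A + σ.N) (flow σ.A σ.b s) t := by
  have hmem : s + t ∈ Icc 0 (stepInput s t hs ht).T := ⟨add_nonneg hs ht, le_rfl⟩
  rw [output, state_of_switching σ (stepInput s t hs ht) (α := 0) (β := 1) hs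
    (fun r _ => rfl) hmem, min_eq_right (le_add_of_nonneg_right ht), add_sub_cancel_left,
    max_eq_left ht, zero_smul, one_smul, add_zero]

end Switching

/-! ### The dual system and the commutator obstruction -/

section Transpose

variable {n : ℕ}

/-- The dual system `(Aᵀ, Nᵀ, cᵀ, bᵀ)`. -/
def FourTuple.dual (σ : FourTuple n) : FourTuple n := (σ.Aᵀ, σ.Nᵀ, σ.c, σ.b)

theorem FourTuple.dual_A (σ : FourTuple n) : σ.dual.A = σ.Aᵀ := rfl

theorem FourTuple.dual_N (σ : FourTuple n) : σ.dual.N = σ.Nᵀ := rfl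

theorem FourTuple.dual_b (σ : FourTuple n) : σ.dual.b = σ.c := rfl

theorem FourTuple.dual_c (σ : FourTuple n) : σ.dual.c = σ.b := rfl

theorem ioEquivOn_constantInputs_dual (σ : FourTuple n) :
    IOEquivOn constantInputs σ σ.dual := by
  rintro u ⟨β, hβ⟩ t ht
  rw [output, output, state_of_constant σ u hβ ht, state_of_constant σ.dual u hβ ht,
    σ.dual_A, σ.dual_N, σ.dual_b, σ.dual_c, ← Matrix.transpose_smul, ← Matrix.transpose_add,
    dotProduct_comm σ.b, flow_transpose_dotProduct]

/-- If two products of flows agree in reverse orders, then the generators commute between `w`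
and `v`. -/
theorem dotProduct_mulVec_comm_of_flow_comm {P Q : Matrix (Fin n) (Fin n) ℝ} {v w : Fin n → ℝ}
    (h : ∀ s t : ℝ, 0 ≤ s → 0 ≤ t → w ⬝ᵥ flow Q (flow P v s) t = w ⬝ᵥ flow P (flow Q v t) s) :
    w ⬝ᵥ Q *ᵥ P *ᵥ v = w ⬝ᵥ P *ᵥ Q *ᵥ v := by
  have hdot : ∀ (z : Fin n → ℝ) {f : ℝ → Fin n → ℝ} {f' : Fin n → ℝ} {t : ℝ},
      HasDerivAt f f' t → HasDerivAt (fun r => z ⬝ᵥ f r) (z ⬝ᵥ f') t := by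
    intro z f f' t hf
    simp only [dotProduct]
    exact HasDerivAt.fun_sum fun i _ => ((hasDerivAt_pi.1 hf) i).const_mul (z i)
  -- Durations are nonnegative, so only right derivatives at 0 can be compared; these already
  -- determine the derivative.
  have huniq : ∀ {f g : ℝ → ℝ} {f' g' : ℝ}, HasDerivAt f f' 0 → HasDerivAt g g' 0 →
      (∀ r, 0 ≤ r → f r = g r) → f' = g' := by
    intro f g f' g' hf hg hfg
    have hg' : HasDerivWithinAt f g' (Ici 0) 0 :=
      hg.hasDerivWithinAt.congr (fun r hr => hfg r hr) (hfg 0 le_rfl)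
    exact (uniqueDiffWithinAt_Ici (0 : ℝ)).eq_deriv _ hf.hasDerivWithinAt hg'
  have hmove : ∀ (z y : Fin n → ℝ) (t : ℝ), z ⬝ᵥ flow Q y t = flow Qᵀ z t ⬝ᵥ y :=
    fun z y t => (flow_transpose_dotProduct Q z y t).symm
  -- Derivative in `s` at 0 with `t` fixed. Moving the outer flow onto `w` turns the left side into
  -- a fixed functional of `flow P v s`.
  have h1 : ∀ t : ℝ, 0 ≤ t → w ⬝ᵥ flow Q (P *ᵥ v) t = w ⬝ᵥ P *ᵥ flow Q v t := by
    intro t ht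
    have e1 := hdot (flow Qᵀ w t) (hasDerivAt_flow P v 0)
    have e2 := hdot w (hasDerivAt_flow P (flow Q v t) 0)
    have := huniq e1 e2 fun s hs => by rw [← hmove]; exact h s t hs ht
    rwa [flow_zero, flow_zero, ← hmove] at this
  have e1 := hdot w (hasDerivAt_flow Q (P *ᵥ v) 0)
  have e2 := hdot (w ᵥ* P) (hasDerivAt_flow Q v 0)
  have := huniq e1 e2 fun t ht => by rw [← Matrix.dotProduct_mulVec]; exact h1 t ht
  rwa [flow_zero, flow_zero, ← Matrix.dotProduct_mulVec] at this

theorem commutator_eq_zero_of_ioEquiv_dual {σ : FourTuple n} (h : IOEquiv σ σ.dual) :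
    σ.c ⬝ᵥ (σ.A * σ.N - σ.N * σ.A) *ᵥ σ.b = 0 := by
  have key := dotProduct_mulVec_comm_of_flow_comm (P := σ.A) (Q := σ.A + σ.N) (v := σ.b)
    (w := σ.c) fun s t hs ht => by
      have := h (stepInput s t hs ht) (mem_univ _) (s + t) ⟨add_nonneg hs ht, le_rfl⟩
      rw [output_stepInput, output_stepInput, σ.dual_A, σ.dual_N, σ.dual_b, σ.dual_c,
        ← Matrix.transpose_add] at this
      rw [this, dotProduct_comm, flow_transpose_dotProduct, flow_transpose_dotProduct]
  simp only [Matrix.add_mulVec, Matrix.mulVec_add, dotProduct_add, Matrix.mulVec_mulVec,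
    add_mul] at key
  rw [Matrix.sub_mulVec, dotProduct_sub]
  linarith

/-- Transposition reverses products, so the commutator changes sign; this keeps the dual of a system
of the generic set inside that set. -/
theorem FourTuple.dual_commutator (σ : FourTuple n) :
    σ.dual.c ⬝ᵥ (σ.dual.A * σ.dual.N - σ.dual.N * σ.dual.A) *ᵥ σ.dual.b
      = -(σ.c ⬝ᵥ (σ.A * σ.N - σ.N * σ.A) *ᵥ σ.b) := by
  rw [σ.dual_A, σ.dual_N, σ.dual_b, σ.dual_c, ← Matrix.transpose_mul, ← Matrix.transpose_mul,
    ← Matrix.transpose_sub, Matrix.mulVec_transpose, dotProduct_comm, ← Matrix.dotProduct_mulVec,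
    ← dotProduct_neg, ← Matrix.neg_mulVec, neg_sub]

end Transpose

/-! ### Genericity of a nonzero commutator pairing -/

section Generic

variable {n : ℕ}

/-- The kernel is a proper subspace, hence null for Haar measure. -/
theorem ae_linearMap_ne_zero {E : Type*} [NormedAddCommGroup E] [NormedSpace ℝ E]
    [MeasurableSpace E] [BorelSpace E] [FiniteDimensional ℝ E] (μ : Measure E)
    [μ.IsAddHaarMeasure] (f : E →ₗ[ℝ] ℝ) (hf : ∃ v, f v ≠ 0) : ∀ᵐ v ∂μ, f v ≠ 0 := by
  have h : μ (LinearMap.ker f : Set E) = 0 := by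
    refine Measure.addHaar_submodule μ _ fun htop => ?_
    obtain ⟨v, hv⟩ := hf
    exact hv (LinearMap.mem_ker.1 (htop ▸ Submodule.mem_top))
  rw [ae_iff]
  simp only [ne_eq, not_not]
  exact h

theorem continuous_commutator : Continuous fun σ : FourTuple n =>
    σ.c ⬝ᵥ (σ.A * σ.N - σ.N * σ.A) *ᵥ σ.b := by
  simp only [dotProduct, Matrix.mulVec, Matrix.sub_apply, Matrix.mul_apply, FourTuple.A,
    FourTuple.N, FourTuple.b, FourTuple.c, Matrix.of_apply]
  fun_prop

/-- The expression is linear in each of `A`, `N`, `b`, `c` separately. By Fubini it suffices to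
choose them in turn, each time avoiding the kernel of a nonzero functional. -/
theorem ae_commutator_ne_zero (hn : 2 ≤ n) : ∀ᵐ σ : FourTuple n,
    σ.c ⬝ᵥ (σ.A * σ.N - σ.N * σ.A) *ᵥ σ.b ≠ 0 := by
  have hmeas : MeasurableSet {σ : FourTuple n |
      σ.c ⬝ᵥ (σ.A * σ.N - σ.N * σ.A) *ᵥ σ.b ≠ 0} :=
    (isOpen_ne_fun continuous_commutator continuous_const).measurableSet
  -- Two distinct indices exist because `n ≥ 2`; for `n = 1` all commutators vanish.
  let i : Fin n := ⟨0, by omega⟩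
  let j : Fin n := ⟨1, by omega⟩
  have hij : i ≠ j := by simp [i, j]
  have hA : ∀ᵐ A : Fin n → Fin n → ℝ, A i j ≠ 0 :=
    ae_linearMap_ne_zero volume ((LinearMap.proj j).comp
      (LinearMap.proj (R := ℝ) (φ := fun _ : Fin n => Fin n → ℝ) i))
      ⟨fun _ _ => 1, by simp⟩
  have hN : ∀ A : Fin n → Fin n → ℝ, A i j ≠ 0 → ∀ᵐ N : Fin n → Fin n → ℝ,
      (Matrix.of A * Matrix.of N - Matrix.of N * Matrix.of A) i j ≠ 0 := by
    intro A hA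
    let f : (Fin n → Fin n → ℝ) →ₗ[ℝ] ℝ :=
      { toFun := fun N => (Matrix.of A * Matrix.of N - Matrix.of N * Matrix.of A) i j
        map_add' := fun M N => by
          simp only [← Matrix.of_add_of, mul_add, add_mul, Matrix.sub_apply, Matrix.add_apply]
          ring
        map_smul' := fun r N => by
          simp only [← Matrix.smul_of, Matrix.mul_smul, Matrix.smul_mul, Matrix.sub_apply,
            Matrix.smul_apply, smul_eq_mul, RingHom.id_apply]
          ring }
    -- For the matrix unit `N = E_ii` with `i ≠ j`, the `(i, j)` entry of `AN - NA` is `-A i j`.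
    refine ae_linearMap_ne_zero volume f ⟨Matrix.single i i 1, ?_⟩
    change (Matrix.of A * Matrix.single i i (1 : ℝ) - Matrix.single i i (1 : ℝ) * Matrix.of A :
      Matrix (Fin n) (Fin n) ℝ) i j ≠ 0
    simpa [hij, hij.symm] using hA
  have hb : ∀ M : Matrix (Fin n) (Fin n) ℝ, M i j ≠ 0 → ∀ᵐ b : Fin n → ℝ, (M *ᵥ b) i ≠ 0 := by
    intro M hM
    exact ae_linearMap_ne_zero volume ((LinearMap.proj i).comp M.mulVecLin)
      ⟨Pi.single j 1, by simpa using hM⟩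
  have hc : ∀ v : Fin n → ℝ, v i ≠ 0 → ∀ᵐ c : Fin n → ℝ, c ⬝ᵥ v ≠ 0 := by
    intro v hv
    let f : (Fin n → ℝ) →ₗ[ℝ] ℝ :=
      { toFun := fun c => c ⬝ᵥ v
        map_add' := fun c d => add_dotProduct c d v
        map_smul' := fun r c => smul_dotProduct r c v }
    refine ae_linearMap_ne_zero volume f ⟨Pi.single i 1, ?_⟩
    change Pi.single i 1 ⬝ᵥ v ≠ 0
    simpa using hv
  refine (Measure.ae_prod_iff_ae_ae hmeas).2 ?_
  filter_upwards [hA] with A hA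
  refine (Measure.ae_prod_iff_ae_ae (measurable_prodMk_left hmeas)).2 ?_
  filter_upwards [hN A hA] with N hN
  refine (Measure.ae_prod_iff_ae_ae
    (measurable_prodMk_left (measurable_prodMk_left hmeas))).2 ?_
  filter_upwards [hb _ hN] with b hb using hc _ hb

/-- Lets density of the generic set follow from its complement being null. -/
theorem isOpenPosMeasure_volume : (volume : Measure (FourTuple n)).IsOpenPosMeasure :=
  haveI := Measure.prod.instIsOpenPosMeasure
    (μ := (volume : Measure (Fin n → Fin n → ℝ)))
    (ν := (volume : Measure ((Fin n → ℝ) × (Fin n → ℝ))))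
  Measure.prod.instIsOpenPosMeasure
    (μ := (volume : Measure (Fin n → Fin n → ℝ)))
    (ν := (volume : Measure ((Fin n → Fin n → ℝ) × (Fin n → ℝ) × (Fin n → ℝ))))

theorem isGeneric_commutator_ne_zero (hn : 2 ≤ n) :
    IsGeneric {σ : FourTuple n | σ.c ⬝ᵥ (σ.A * σ.N - σ.N * σ.A) *ᵥ σ.b ≠ 0} :=
  haveI := isOpenPosMeasure_volume (n := n)
  ⟨ae_commutator_ne_zero hn, isOpen_ne_fun continuous_commutator continuous_const,
    Measure.dense_of_ae (μ := volume) (ae_commutator_ne_zero hn)⟩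

end Generic

end BilinearSys

theorem corollary1 (n : ℕ) (hn : 2 ≤ n) :
    ∃ G : Set (BilinearSys.FourTuple n), BilinearSys.IsGeneric G ∧
      ∀ σ ∈ G, ∃ σ' ∈ G,
        BilinearSys.IOEquivOn BilinearSys.constantInputs σ σ' ∧
          ¬ BilinearSys.IOEquiv σ σ' := by
  refine ⟨_, BilinearSys.isGeneric_commutator_ne_zero hn, fun σ hσ => ⟨σ.dual, ?_,
    BilinearSys.ioEquivOn_constantInputs_dual σ,
    fun h => hσ (BilinearSys.commutator_eq_zero_of_ioEquiv_dual h)⟩⟩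
  rw [mem_ofPred_eq, σ.dual_commutator]
  exact neg_ne_zero.2 hσ
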